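/- **Setting.** Let $K\subset\mathbb R^p$ be compact. Let $\mathcal M(K)$ be the space of Radon measures on $K$, i.e. the topological dual of $\mathcal C(K)$ with the weak-$*$ topology, let $\langle\mu,g\rangle$ be the pairing, and let $\mathcal M_+(K)$ be the cone of nonnegative measures. Let $a_1,\dots,a_d\in\mathcal C(K)$, $a_i\ge 0$, let $(A\mu)_i=\langle\mu,a_i\rangle$ and $A^*\lambda=\sum_i\lambda_i a_i$. For $t\in[0,1]$ let $\mathcal W_t:\mathcal M(K)\to\mathcal M(K)$ be linear and weak-$*$ continuous, with adjoint $\mathcal W_t^*:\mathcal C(K)\to\mathcal C(K)$. Assume that $\mu\ge 0$ implies $\mathcal W_t\mu\ge 0$ for all $t$, that $t\mapsto\langle\mathcal W_t\mu,g\rangle$ is measurable for all $\mu\in\mathcal M_+(K)$, $g\in\mathcal C(K)$, and that $\int_0^1\|\mathcal W_t^*1\|_\infty\,dt<\infty$. **Statistical model.** For $\mu\in\mathcal M_+(K)$ let $m_\mu$ be the measure $[t_1,t_2]\times B\mapsto\int_{t_1}^{t_2}(\mathcal W_t\mu)(B)\,dt$ on $[0,1]\times K$. The numbers $a_i(x)$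 are relative detection probabilities: for a constant $c>0$ with $\sum_i a_i\le c$ on $K$ ($c=1$ if the $a_i$ are probabilities), emissions form a Poisson point process on $[0,1]\times K$ of intensity measure $c\,m_\mu$, and, given the emissions, each of them, if it is located at $(t,x)$, is independently detected at time $t$ by detector $i$ with probability $a_i(x)/c$, or is not detected, with probability $1-\sum_i a_i(x)/c$. The data $y$ are the numbers $n_i$ of detections and the (unordered) detection times $t^i_j\in[0,1]$, $1\le j\le n_i$, for each detector $i=1,\dots,d$. **Loss.** Let $f:=\int_0^1\mathcal W_t^*A^*\mathbf 1\,dt$, where $\mathbf 1=(1,\dots,1)$, and let $\Gamma$ be the family (with repetitions) of the $n=\sum_i n_i$ functions $\mathcal W_{t^i_j}^*a_i$, $1\le i\le d$, $1\le j\le n_i$. For $\mu\in\mathcal M_+(K)$ put $$\ell(\mu)=\ell_y(\mu):=\langle\mu,f\rangle-\sum_{\gamma\in\Gamma}\log\langle\mu,\gamma\rangle ,$$ with $\ell(\mu)=+\infty$ if $\mu\notin\operatorname{dom}(\ell)=\{\mu\in\mathcal M_+(K):\langle\mu,\gamma\rangle>0\ \ \forall\gamma\in\Gamma\}$. **Statement.**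 The integral that defines $f$ converges as a Bochner integral in $\mathcal C(K)$, and for all $\mu\in\mathcal M_+(K)$ the functions $\beta_i(t):=(A\mathcal W_t\mu)_i$ belong to $L^1(0,1)$. Put $$L(\mu;y):=\prod_{i=1}^d\Big(e^{-\int_0^1\beta_i(t)\,dt}\prod_{j=1}^{n_i}\beta_i(t^i_j)\Big).$$ 1. $L$ is a likelihood function of the model: for every $\mu\in\mathcal M_+(K)$ and every admissible $c$, $L(\mu;\cdot)$ is measurable, and it is the density of the law of the data with respect to the reference measure on list-mode data, which does not depend on $\mu$ and is the product over the $d$ detectors of the measures $\sum_{n\ge 0}\frac1{n!}\,dt_1\cdots dt_n$. Here data are identified with the point measures $\sum_j\delta_{t^i_j}$, $i=1,\dots,d$, i.e. both the law and the measure with this density are pushed forward to $d$-tuples of measures on $[0,1]$. 2. For all data $y$ and all $\mu\in\mathcal M_+(K)$, $-\log L(\mu;y)=\ell_y(\mu)$ in $[-\infty,+\infty]$, where $-\log 0=+\infty$. 3. Hence the maximum likelihood problem is $\min_{\mu\in\mathcal M_+(K)}\ell_y(\mu)$: for all data $y$, a measure $\mu^\star\in\mathcal M_+(K)$ maximises $L(\cdot\,;y)$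 over $\mathcal M_+(K)$ if and only if it minimises $\ell_y$ over $\mathcal M_+(K)$. -/

import Mathlib

open MeasureTheory ProbabilityTheory Set
open scoped unitInterval ENNReal NNReal

noncomputable section

namespace ListModePET

/-! ### Radon measures and operators on them -/

section Radon

variable {X : Type*} [TopologicalSpace X]

/-- The space `M(X)` of (signed) Radon measures on a compact space `X`: the topological dual of
`C(X)`, with its weak-star topology. The pairing of `μ` with `g` is `μ g`. -/
abbrev Radon (X : Type*) [TopologicalSpace X] : Type _ := WeakDual ℝ C(X, ℝ)

/-- `μ ≥ 0`, tested against nonnegative continuous functions. -/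
def IsNonneg (μ : Radon X) : Prop := ∀ g : C(X, ℝ), 0 ≤ g → 0 ≤ μ g

/-- The cone `M₊(X)` of nonnegative Radon measures. -/
abbrev PosRadon (X : Type*) [TopologicalSpace X] : Type _ := {μ : Radon X // IsNonneg μ}

theorem exists_adjoint (T : Radon X →L[ℝ] Radon X) (g : C(X, ℝ)) :
    ∃ h : C(X, ℝ), ∀ μ : Radon X, T μ g = μ h := by
  let ev : Radon X →L[ℝ] ℝ := WeakBilin.eval (topDualPairing ℝ C(X, ℝ)) g
  obtain ⟨h, hh⟩ :=
    LinearMap.dualEmbedding_surjective (topDualPairing ℝ C(X, ℝ)) (ev.comp T)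
  exact ⟨h, fun μ => (DFunLike.congr_fun hh μ).symm⟩

/-- The adjoint `T* : C(X) → C(X)` of a weak-star continuous operator `T` on `M(X)`,
characterised by `adjoint_spec`. -/
def adjoint (T : Radon X →L[ℝ] Radon X) (g : C(X, ℝ)) : C(X, ℝ) := (exists_adjoint T g).choose

theorem adjoint_spec (T : Radon X →L[ℝ] Radon X) (g : C(X, ℝ)) (μ : Radon X) :
    T μ g = μ (adjoint T g) := (exists_adjoint T g).choose_spec μ

variable [CompactSpace X] [T2Space X] [MeasurableSpace X] [BorelSpace X]

/-- A nonnegative Radon measure as a positive functional on compactly supported functions. -/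
def PosRadon.functional (μ : PosRadon X) : CompactlySupportedContinuousMap X ℝ →ₚ[ℝ] ℝ :=
  PositiveLinearMap.mk₀
    { toFun := fun g => μ.1 (g : C(X, ℝ))
      map_add' := fun g h => map_add μ.1 (g : C(X, ℝ)) (h : C(X, ℝ))
      map_smul' := fun c g => map_smul μ.1 c (g : C(X, ℝ)) }
    fun g hg => μ.2 (g : C(X, ℝ)) fun x => hg x

/-- The Borel measure that represents a nonnegative Radon measure (Riesz-Markov-Kakutani). -/
def PosRadon.borel (μ : PosRadon X) : Measure X := RealRMK.rieszMeasure μ.functional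

theorem PosRadon.integral_borel (μ : PosRadon X) (g : C(X, ℝ)) :
    ∫ x, g x ∂μ.borel = μ.1 g :=
  RealRMK.integral_rieszMeasure μ.functional
    (CompactlySupportedContinuousMap.continuousMapEquiv g)

end Radon

/-! ### Poisson point processes, thinning -/

section Processes

variable {Ω S : Type*} [MeasurableSpace Ω] [MeasurableSpace S]

/-- The Poisson distribution of mean `r ∈ [0, ∞]` on `[0, ∞]`. -/
def poissonENNReal (r : ℝ≥0∞) : Measure ℝ≥0∞ :=
  if r = ⊤ then Measure.dirac ⊤ else (poissonMeasure r.toNNReal).map fun n : ℕ => (n : ℝ≥0∞)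

/-- The random measure `η` is a Poisson point process of intensity measure `m`: numbers of points
in measurable sets are Poisson, and independent for disjoint sets. -/
structure IsPoissonProcess (P : Measure Ω) (η : Ω → Measure S) (m : Measure S) : Prop where
  measurable : Measurable η
  count_law : ∀ B : Set S, MeasurableSet B → P.map (fun ω => η ω B) = poissonENNReal (m B)
  count_indep : ∀ (n : ℕ) (B : Fin n → Set S), (∀ j, MeasurableSet (B j)) →
    Pairwise (fun j k => Disjoint (B j) (B k)) → iIndepFun (fun j ω => η ω (B j)) P

variable {X : Type*} [MeasurableSpace X] {d : ℕ}

/-- Probability that a point emitted at `x` ends up with the mark `e`, where `some i` means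
"detected in detector `i`", of probability `p i x`, and `none` means "not detected". -/
def markProb (p : Fin d → X → ℝ) : Option (Fin d) → X → ℝ
  | some i => p i
  | none => fun x => 1 - ∑ i, p i x

/-- An emission and detection experiment. There are `N` emissions, the `k`-th one at the time and
position `Z k`, and they form a Poisson point process of intensity measure `m` on time-space.
Given the emissions, each is independently detected in detector `i` with probability `p i x`,
where `x` is its position, or not detected at all; `D k` records the result for the `k`-th one.
The values of `Z k` and `D k` for `k ≥ N` play no role. -/
structure IsExperiment (P : Measure Ω) (m : Measure (I × X)) (p : Fin d → X → ℝ)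
    (N : Ω → ℕ) (Z : ℕ → Ω → I × X) (D : ℕ → Ω → Option (Fin d)) : Prop where
  measurable_num : Measurable N
  measurable_point : ∀ k, Measurable (Z k)
  measurableSet_mark : ∀ k e, MeasurableSet {ω | D k ω = e}
  emission : IsPoissonProcess P (fun ω => ∑ k ∈ Finset.range (N ω), Measure.dirac (Z k ω)) m
  detection : ∀ (n : ℕ) (e : Fin n → Option (Fin d)) (E : Set (Fin n → I × X)), MeasurableSet E →
    P {ω | (N ω = n ∧ (fun k : Fin n => Z k ω) ∈ E) ∧ ∀ k : Fin n, D k ω = e k} =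
      ∫⁻ ω in {ω | N ω = n ∧ (fun k : Fin n => Z k ω) ∈ E},
        ∏ k : Fin n, ENNReal.ofReal (markProb p (e k) (Z k ω).2) ∂P

/-- The observation: for every detector, the point measure on `[0, 1]` of the times at which it
detects (detection takes place at the time of emission). -/
def observation (N : Ω → ℕ) (Z : ℕ → Ω → I × X) (D : ℕ → Ω → Option (Fin d)) (ω : Ω) :
    Fin d → Measure I :=
  fun i => ∑ k ∈ (Finset.range (N ω)).filter (fun k => D k ω = some i), Measure.dirac (Z k ω).1

end Processes

/-! ### List-mode data -/

/-- List-mode data for `d` detectors: for each detector `i`, a number `n_i = (y i).1` of detections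
and detection times `t_j^i = (y i).2 j` in `[0, 1]`. -/
abbrev Data (d : ℕ) : Type := Fin d → (n : ℕ) × (Fin n → I)

/-- List-mode data as point measures on `[0, 1]`; this forgets the order of the times. -/
def Data.toPoints {d : ℕ} (y : Data d) : Fin d → Measure I :=
  fun i => ∑ j, Measure.dirac ((y i).2 j)

/-- The measure `∑ₙ (1 / n!) dt₁ ⋯ dtₙ` on finite lists of times. -/
def refList : Measure ((n : ℕ) × (Fin n → I)) :=
  Measure.sum fun n : ℕ =>
    ((n.factorial : ℝ≥0∞)⁻¹) • (volume : Measure (Fin n → I)).map (Sigma.mk n)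

/-- The reference measure on list-mode data with respect to which likelihoods are densities; the
factor `1 / n!` is there because the times of a detector carry no order. -/
def refData (d : ℕ) : Measure (Data d) := Measure.pi fun _ => refList

/-! ### The tomography model -/

section Model

variable {X : Type*} [TopologicalSpace X] {d : ℕ}

/-- The operator `A : M(X) → ℝ^d`, `(A μ)_i = ⟨μ, a_i⟩`. -/
def petOp (a : Fin d → C(X, ℝ)) (μ : Radon X) : Fin d → ℝ := fun i => μ (a i)

/-- Its adjoint `A* : ℝ^d → C(X)`, `A* v = ∑ v_i a_i`. -/
def petAdjoint (a : Fin d → C(X, ℝ)) (v : Fin d → ℝ) : C(X, ℝ) := ∑ i, v i • a i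

/-- `μ ≥ 0` implies `W_t μ ≥ 0`. -/
def PreservesNonneg (W : I → Radon X →L[ℝ] Radon X) : Prop :=
  ∀ t (μ : Radon X), IsNonneg μ → IsNonneg (W t μ)

/-- The activity `W_t μ` at time `t`, as an element of `M₊(X)`. -/
def activity (W : I → Radon X →L[ℝ] Radon X) (hW : PreservesNonneg W) (μ : PosRadon X) (t : I) :
    PosRadon X := ⟨W t μ.1, hW t μ.1 μ.2⟩

/-- The detection intensity `β_i(t) = (A W_t μ)_i`. -/
def detIntensity (a : Fin d → C(X, ℝ)) (W : I → Radon X →L[ℝ] Radon X) (μ : PosRadon X)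
    (i : Fin d) (t : I) : ℝ := petOp a (W t μ.1) i

/-- The likelihood of `μ` given the data `y`: the product over the detectors of
`exp (-∫ β_i) ∏_j β_i(t_j^i)`. -/
def likelihood (a : Fin d → C(X, ℝ)) (W : I → Radon X →L[ℝ] Radon X) (μ : PosRadon X)
    (y : Data d) : ℝ≥0∞ :=
  ENNReal.ofReal (∏ i, (Real.exp (-∫ t : I, detIntensity a W μ i t) *
    ∏ j, detIntensity a W μ i ((y i).2 j)))

/-- The family `Γ` of the functions `W_{t_j^i}* a_i`, one for each detection. -/
def Gam (a : Fin d → C(X, ℝ)) (W : I → Radon X →L[ℝ] Radon X) (y : Data d)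
    (e : (i : Fin d) × Fin (y i).1) : C(X, ℝ) := adjoint (W ((y e.1).2 e.2)) (a e.1)

variable [CompactSpace X]

/-- `f = ∫₀¹ W_t* A* 1 dt`, a Bochner integral in `C(X)`. -/
def backproj (a : Fin d → C(X, ℝ)) (W : I → Radon X →L[ℝ] Radon X) : C(X, ℝ) :=
  ∫ t : I, adjoint (W t) (petAdjoint a fun _ => 1)

open scoped Classical in
/-- The loss `ℓ(μ) = ⟨μ, f⟩ - ∑_{γ ∈ Γ} log ⟨μ, γ⟩`, with value `+∞` unless all `⟨μ, γ⟩` are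
positive. -/
def loss (a : Fin d → C(X, ℝ)) (W : I → Radon X →L[ℝ] Radon X) (y : Data d) (μ : PosRadon X) :
    EReal :=
  if ∀ e, 0 < μ.1 (Gam a W y e) then
    ((μ.1 (backproj a W) - ∑ e, Real.log (μ.1 (Gam a W y e)) : ℝ) : EReal)
  else ⊤

variable [T2Space X] [MeasurableSpace X] [BorelSpace X]

/-- The measure `[t₁, t₂] × B ↦ ∫_{t₁}^{t₂} (W_t μ)(B) dt` on `[0, 1] × X`. -/
def timeSpaceMeasure (W : I → Radon X →L[ℝ] Radon X) (hW : PreservesNonneg W) (μ : PosRadon X) :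
    Measure (I × X) :=
  (volume : Measure I).bind fun t => (activity W hW μ t).borel.map (Prod.mk t)

end Model

end ListModePET

end

open ListModePET

/-!
The law of a random family of measures `ν` is determined by its Laplace functional
`u ↦ E[exp (-∑ i, ∫ u i dν i)]`: on finite-dimensional marginals this is the Stone-Weierstrass
theorem. A Poisson process of intensity `m` has Laplace functional `exp (-∫ (1 - exp (-u)) dm)`,
and independent marking replaces the weight of a point by its conditional mean. Hence the
detections have the Laplace functional of independent Poisson processes whose intensities are the
projections of `a i • m_μ` to the time axis, that is `β i dt`. Summing the exponential series of
the reference measure gives the same functional for the measure with density `L(μ; ·)`.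

The adjoints of the `W t` are integrable by domination: pairing with Dirac measures and positivity
give `‖adjoint (W t) g‖ ≤ ‖g‖ * ‖adjoint (W t) 1‖`. Moving them and the Bochner integral through
`μ` turns `-log L` into the loss.
-/

namespace ListModePET

section ExpNeg

/-- The function `x ↦ exp (-x)` on `[0, ∞]`, with `exp (-∞) = 0`. Its values at integrals against a
random measure form the Laplace functional of the random measure. -/
noncomputable def expNeg (x : ℝ≥0∞) : ℝ≥0∞ := EReal.exp (-(x : EReal))

@[simp]
theorem expNeg_zero : expNeg 0 = 1 := by simp [expNeg]

theorem expNeg_add (x y : ℝ≥0∞) : expNeg (x + y) = expNeg x * expNeg y := by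
  rw [expNeg, expNeg, expNeg, ← EReal.exp_add, EReal.coe_ennreal_add, EReal.neg_add,
    sub_eq_add_neg] <;> simp

theorem expNeg_sum {ι : Type*} (s : Finset ι) (x : ι → ℝ≥0∞) :
    expNeg (∑ i ∈ s, x i) = ∏ i ∈ s, expNeg (x i) := by
  induction s using Finset.cons_induction with
  | empty => simp
  | cons i s hi ih => rw [Finset.sum_cons, Finset.prod_cons, expNeg_add, ih]

theorem expNeg_natCast_mul (n : ℕ) (x : ℝ≥0∞) : expNeg (n * x) = expNeg x ^ n := by
  rw [← nsmul_eq_mul, ← Finset.card_range n, ← Finset.sum_const, expNeg_sum, Finset.prod_const]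

theorem expNeg_le_one (x : ℝ≥0∞) : expNeg x ≤ 1 := by
  rw [expNeg, EReal.exp_le_one_iff, EReal.neg_le, neg_zero]
  exact EReal.coe_ennreal_nonneg x

theorem expNeg_ne_top (x : ℝ≥0∞) : expNeg x ≠ ⊤ := ne_top_of_le_ne_top (by simp) (expNeg_le_one x)

theorem expNeg_injective : Function.Injective expNeg := fun x y h => by
  simpa [expNeg] using EReal.exp_strictMono.injective h

theorem antitone_expNeg : Antitone expNeg := fun _ _ h =>
  EReal.exp_monotone <| EReal.neg_le_neg_iff.2 <| EReal.coe_ennreal_le_coe_ennreal_iff.2 h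

theorem continuous_expNeg : Continuous expNeg :=
  ENNReal.continuous_exp.comp (continuous_neg.comp continuous_coe_ennreal_ereal)

theorem measurable_expNeg : Measurable expNeg := continuous_expNeg.measurable

theorem expNeg_ofReal {x : ℝ} (hx : 0 ≤ x) :
    expNeg (ENNReal.ofReal x) = ENNReal.ofReal (Real.exp (-x)) := by
  rw [expNeg, EReal.coe_ennreal_ofReal, max_eq_left hx, ← EReal.coe_neg, EReal.exp_coe]

theorem expNeg_toENNReal_neg_log {x : ℝ≥0∞} (hx : x ≤ 1) :
    expNeg (-x.log).toENNReal = x := by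
  have hlog : 0 ≤ -x.log := by
    rw [EReal.le_neg, neg_zero]
    exact ENNReal.log_le_zero_iff.2 hx
  rw [expNeg, EReal.coe_toENNReal hlog, neg_neg, ENNReal.exp_log]

theorem exp_mul_expNeg_add {x y : ℝ≥0∞} (hy : y ≠ ⊤) :
    EReal.exp y * expNeg (y + x) = expNeg x := by
  have h : EReal.exp y * expNeg y = 1 := by
    rw [expNeg, ← EReal.exp_add, ← sub_eq_add_neg, EReal.sub_self (by simpa using hy) (by simp),
      EReal.exp_zero]
  rw [expNeg_add, ← mul_assoc, h, one_mul]

end ExpNeg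

/-! ### Laplace functionals determine laws of random measures -/

section LaplaceTransform

open scoped BoundedContinuousFunction

variable {ι : Type*} [Fintype ι]

/-- The bounded continuous functions `x ↦ exp (-∑ j, k j * x j)` on `[0, ∞]^ι`, for `k : ι → ℕ`.
They are bundled as a homomorphism in `k`, so that they span an algebra. -/
noncomputable def laplaceCharacter (ι : Type*) [Fintype ι] :
    Multiplicative (ι → ℕ) →* ((ι → ℝ≥0∞) →ᵇ ℝ) where
  toFun k := .ofNormedAddCommGroup (fun x => ∏ j, (expNeg (x j)).toReal ^ k.toAdd j)
    (continuous_finsetProd _ fun j _ => (ENNReal.continuousOn_toReal.comp_continuous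
      (continuous_expNeg.comp (continuous_apply j)) fun x => expNeg_ne_top _).pow _) 1
    fun x => by
      rw [Real.norm_of_nonneg (by positivity)]
      exact Finset.prod_le_one (fun j _ => by positivity) fun j _ =>
        pow_le_one₀ ENNReal.toReal_nonneg (ENNReal.toReal_mono ENNReal.one_ne_top (expNeg_le_one _))
  map_one' := by ext; simp
  map_mul' k l := by ext; simp [pow_add, Finset.prod_mul_distrib]

theorem laplaceCharacter_apply (k : ι → ℕ) (x : ι → ℝ≥0∞) :
    laplaceCharacter ι (.ofAdd k) x = (expNeg (∑ j, k j * x j)).toReal := by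
  simp [laplaceCharacter, expNeg_sum, expNeg_natCast_mul]

theorem integral_laplaceCharacter (P : Measure (ι → ℝ≥0∞)) (k : ι → ℕ) :
    ∫ x, laplaceCharacter ι (.ofAdd k) x ∂P = (∫⁻ x, expNeg (∑ j, k j * x j) ∂P).toReal := by
  simp_rw [laplaceCharacter_apply]
  refine integral_toReal (measurable_expNeg.comp ?_).aemeasurable
    (ae_of_all _ fun x => (expNeg_ne_top _).lt_top)
  exact Finset.measurable_sum _ fun j _ => (measurable_pi_apply j).const_mul _

theorem exists_laplaceCharacter_ne {x y : ι → ℝ≥0∞} (hxy : x ≠ y) :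
    ∃ k, laplaceCharacter ι k x ≠ laplaceCharacter ι k y := by
  classical
  obtain ⟨j, hj⟩ := Function.ne_iff.1 hxy
  refine ⟨.ofAdd (Pi.single j 1), fun h => hj (expNeg_injective ?_)⟩
  simpa [laplaceCharacter_apply, Pi.single_apply, ENNReal.toReal_eq_toReal_iff', expNeg_ne_top]
    using h

/-- The span of the functions `laplaceCharacter ι k`, to which the Stone-Weierstrass theorem
applies. -/
noncomputable def laplaceAlgebra (ι : Type*) [Fintype ι] :
    StarSubalgebra ℝ ((ι → ℝ≥0∞) →ᵇ ℝ) where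
  toSubalgebra := Algebra.adjoin ℝ (MonoidHom.mrange (laplaceCharacter ι))
  star_mem' hf := by
    rwa [show star _ = _ from BoundedContinuousFunction.ext fun _ => star_trivial _]

theorem integral_eq_of_mem_laplaceAlgebra {P Q : Measure (ι → ℝ≥0∞)} [IsFiniteMeasure P]
    [IsFiniteMeasure Q]
    (h : ∀ k : ι → ℕ, ∫⁻ x, expNeg (∑ j, k j * x j) ∂P = ∫⁻ x, expNeg (∑ j, k j * x j) ∂Q)
    {g : (ι → ℝ≥0∞) →ᵇ ℝ} (hg : g ∈ laplaceAlgebra ι) : ∫ x, g x ∂P = ∫ x, g x ∂Q := by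
  change g ∈ Subalgebra.toSubmodule (Algebra.adjoin ℝ _) at hg
  rw [Algebra.adjoin_eq_span, Submonoid.closure_eq] at hg
  induction hg using Submodule.span_induction with
  | mem g hg =>
    obtain ⟨k, rfl⟩ := hg
    exact (integral_laplaceCharacter P k.toAdd).trans <|
      (congrArg _ (h k.toAdd)).trans (integral_laplaceCharacter Q k.toAdd).symm
  | zero => simp
  | add f g _ _ hf hg =>
    simp only [BoundedContinuousFunction.coe_add, Pi.add_apply]
    rw [integral_add (f.integrable P) (g.integrable P),
      integral_add (f.integrable Q) (g.integrable Q), hf, hg]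
  | smul c g _ hg => simp only [BoundedContinuousFunction.coe_smul, integral_smul, hg]

theorem ext_of_lintegral_expNeg {P Q : Measure (ι → ℝ≥0∞)} [IsFiniteMeasure P] [IsFiniteMeasure Q]
    (h : ∀ k : ι → ℕ, ∫⁻ x, expNeg (∑ j, k j * x j) ∂P = ∫⁻ x, expNeg (∑ j, k j * x j) ∂Q) :
    P = Q := by
  refine ext_of_forall_mem_subalgebra_integral_eq_of_polish (𝕜 := ℝ) (A := laplaceAlgebra ι) ?_
    fun g hg => integral_eq_of_mem_laplaceAlgebra h hg
  intro x y hxy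
  obtain ⟨k, hk⟩ := exists_laplaceCharacter_ne hxy
  have hmem : laplaceCharacter ι k ∈ laplaceAlgebra ι := Algebra.subset_adjoin ⟨k, rfl⟩
  exact ⟨laplaceCharacter ι k, ⟨_, ⟨_, hmem, rfl⟩, rfl⟩, hk⟩

end LaplaceTransform

section LaplaceFunctional

theorem measure_eq_of_map_eq_of_comap {α β : Type*} [mα : MeasurableSpace α]
    [mβ : MeasurableSpace β] {f : α → β} (hf : mα = mβ.comap f) {P Q : Measure α}
    (h : P.map f = Q.map f) : P = Q := by
  subst hf
  refine @Measure.ext _ (mβ.comap f) _ _ ?_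
  rintro _ ⟨B, hB, rfl⟩
  rw [← Measure.map_apply (comap_measurable f) hB, h, Measure.map_apply (comap_measurable f) hB]

variable {ι S : Type*} [MeasurableSpace S]

/-- The values of a family of measures on all measurable sets, as a point of a product of copies of
`[0, ∞]`. They generate the σ-algebra of `ι → Measure S`. -/
def measureValues (ν : ι → Measure S) (j : ι × {B : Set S // MeasurableSet B}) : ℝ≥0∞ :=
  ν j.1 j.2

theorem measurable_measureValues : Measurable (measureValues (ι := ι) (S := S)) :=
  measurable_pi_lambda _ fun j => (Measure.measurable_coe j.2.2).comp (measurable_pi_apply j.1)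

theorem measurableSpace_eq_comap_measureValues :
    (MeasurableSpace.pi : MeasurableSpace (ι → Measure S)) =
      MeasurableSpace.pi.comap measureValues := by
  refine le_antisymm (iSup_le fun i => ?_) measurable_measureValues.comap_le
  rw [← measurable_iff_comap_le]
  refine @Measure.measurable_of_measurable_coe _ _ _ (MeasurableSpace.comap measureValues _) _
    fun B hB => ?_
  exact (measurable_pi_apply (i, (⟨B, hB⟩ : {B : Set S // MeasurableSet B}))).comp
    (comap_measurable measureValues)

theorem ext_of_map_finset_restrict {κ : Type*} {E : κ → Type*} [∀ j, MeasurableSpace (E j)]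
    {P Q : Measure (∀ j, E j)} [IsFiniteMeasure P]
    (h : ∀ J : Finset κ, P.map J.restrict = Q.map J.restrict) : P = Q := by
  have (J : Finset κ) : IsFiniteMeasure (P.map J.restrict) := inferInstance
  exact IsProjectiveLimit.unique (P := fun J => P.map J.restrict) (fun _ => rfl)
    fun J => (h J).symm

theorem exists_sum_lintegral_eq_sum_measureValues [Fintype ι]
    (J : Finset (ι × {B : Set S // MeasurableSet B})) (k : J → ℕ) :
    ∃ u : ι → S → ℝ≥0∞, (∀ i, Measurable (u i)) ∧
      ∀ ν : ι → Measure S, ∑ i, ∫⁻ s, u i s ∂ν i = ∑ j, k j * J.restrict (measureValues ν) j := by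
  classical
  have hind (j : J) : Measurable fun s => (k j : ℝ≥0∞) * (j.1.2 : Set S).indicator 1 s :=
    (measurable_one.indicator j.1.2.2).const_mul _
  refine ⟨fun i s => ∑ j with j.1.1 = i, k j * (j.1.2 : Set S).indicator 1 s,
    fun i => Finset.measurable_sum _ fun j _ => hind j, fun ν => ?_⟩
  rw [← Finset.sum_fiberwise (s := Finset.univ) (g := fun j : J => j.1.1)]
  refine Finset.sum_congr rfl fun i _ => ?_
  rw [lintegral_finsetSum _ fun j _ => hind j]
  refine Finset.sum_congr rfl fun j hj => ?_
  rw [lintegral_const_mul _ (measurable_one.indicator j.1.2.2), lintegral_indicator_one j.1.2.2,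
    ← (Finset.mem_filter.1 hj).2]
  rfl

variable [Fintype ι] {P Q : Measure (ι → Measure S)}

theorem measurable_expNeg_sum_lintegral {u : ι → S → ℝ≥0∞} (hu : ∀ i, Measurable (u i)) :
    Measurable fun ν : ι → Measure S => expNeg (∑ i, ∫⁻ s, u i s ∂ν i) :=
  measurable_expNeg.comp <| Finset.measurable_sum _ fun i _ =>
    (Measure.measurable_lintegral (hu i)).comp (measurable_pi_apply i)

theorem ext_of_laplaceFunctional [IsFiniteMeasure P]
    (h : ∀ u : ι → S → ℝ≥0∞, (∀ i, Measurable (u i)) →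
      ∫⁻ ν, expNeg (∑ i, ∫⁻ s, u i s ∂ν i) ∂P = ∫⁻ ν, expNeg (∑ i, ∫⁻ s, u i s ∂ν i) ∂Q) :
    P = Q := by
  have : IsFiniteMeasure Q := ⟨by
    have h0 : P univ = Q univ := by simpa using h 0 fun _ => measurable_zero
    exact h0 ▸ measure_lt_top P univ⟩
  have hval := measurable_measureValues (ι := ι) (S := S)
  refine measure_eq_of_map_eq_of_comap measurableSpace_eq_comap_measureValues <|
    ext_of_map_finset_restrict fun J => ?_
  rw [Measure.map_map J.measurable_restrict hval, Measure.map_map J.measurable_restrict hval]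
  refine ext_of_lintegral_expNeg fun k => ?_
  have hk : Measurable fun x : J → ℝ≥0∞ => expNeg (∑ j, k j * x j) :=
    measurable_expNeg.comp <|
      Finset.measurable_sum _ fun j _ => (measurable_pi_apply j).const_mul _
  obtain ⟨u, hu, hsum⟩ := exists_sum_lintegral_eq_sum_measureValues J k
  rw [lintegral_map hk (J.measurable_restrict.comp hval),
    lintegral_map hk (J.measurable_restrict.comp hval)]
  simpa only [Function.comp_apply, hsum] using h u hu

end LaplaceFunctional

/-! ### Poisson processes and independent marking -/

section Poisson

open scoped Nat

theorem ofReal_pow_div_factorial (x : ℝ≥0) (n : ℕ) :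
    ENNReal.ofReal ((x : ℝ) ^ n / n !) = (n ! : ℝ≥0∞)⁻¹ * (x : ℝ≥0∞) ^ n := by
  rw [ENNReal.ofReal_div_of_pos (by positivity), ENNReal.ofReal_pow x.coe_nonneg,
    ENNReal.ofReal_natCast, ENNReal.ofReal_coe_nnreal, ENNReal.div_eq_inv_mul]

theorem tsum_inv_factorial_mul_pow (x : ℝ≥0∞) :
    ∑' n : ℕ, (n ! : ℝ≥0∞)⁻¹ * x ^ n = EReal.exp x := by
  cases x with
  | top =>
    refine (top_unique ?_).trans (by simp)
    exact le_trans (by simp) (ENNReal.le_tsum (f := fun n : ℕ => (n ! : ℝ≥0∞)⁻¹ * ⊤ ^ n) 1)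
  | coe x =>
    have h := NormedSpace.expSeries_div_hasSum_exp (x : ℝ)
    rw [← Real.exp_eq_exp_ℝ] at h
    simp_rw [← ofReal_pow_div_factorial]
    rw [← ENNReal.ofReal_tsum_of_nonneg (fun n => by positivity) h.summable, h.tsum_eq]
    rfl

instance isProbabilityMeasure_poissonENNReal (r : ℝ≥0∞) :
    IsProbabilityMeasure (poissonENNReal r) := by
  unfold poissonENNReal
  split_ifs <;> infer_instance

theorem lintegral_poissonMeasure (r : ℝ≥0) (f : ℕ → ℝ≥0∞) :
    ∫⁻ n, f n ∂poissonMeasure r = expNeg r * ∑' n : ℕ, (n ! : ℝ≥0∞)⁻¹ * (r : ℝ≥0∞) ^ n * f n := by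
  rw [poissonMeasure, lintegral_sum_measure, ← ENNReal.tsum_mul_left]
  refine tsum_congr fun n => ?_
  rw [lintegral_smul_measure, lintegral_dirac, smul_eq_mul, mul_div_assoc,
    ENNReal.ofReal_mul (Real.exp_pos _).le, ← expNeg_ofReal r.coe_nonneg,
    ENNReal.ofReal_coe_nnreal, ofReal_pow_div_factorial, mul_assoc]

theorem lintegral_expNeg_mul_poissonENNReal (r v : ℝ≥0∞) :
    ∫⁻ x, expNeg (v * x) ∂poissonENNReal r = expNeg (r * (1 - expNeg v)) := by
  have hm : Measurable fun x => expNeg (v * x) := measurable_expNeg.comp (by fun_prop)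
  cases r with
  | top =>
    rw [poissonENNReal, if_pos rfl, lintegral_dirac' _ hm]
    rcases eq_or_ne v 0 with rfl | hv
    · simp
    · have hlt : expNeg v < 1 :=
        (expNeg_le_one v).lt_of_ne fun h => hv (expNeg_injective (h.trans expNeg_zero.symm))
      rw [ENNReal.mul_top hv, ENNReal.top_mul (tsub_pos_of_lt hlt).ne']
  | coe r =>
    have hr : (r : ℝ≥0∞) = r * expNeg v + r * (1 - expNeg v) := by
      rw [← mul_add, add_tsub_cancel_of_le (expNeg_le_one v), mul_one]
    rw [poissonENNReal, if_neg ENNReal.coe_ne_top, lintegral_map hm (by fun_prop),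
      lintegral_poissonMeasure, ENNReal.toNNReal_coe]
    simp_rw [mul_comm v, expNeg_natCast_mul, mul_assoc, ← mul_pow]
    rw [tsum_inv_factorial_mul_pow, mul_comm]
    nth_rw 2 [hr]
    exact exp_mul_expNeg_add (ENNReal.mul_ne_top ENNReal.coe_ne_top (expNeg_ne_top v))

variable {Ω S : Type*} [MeasurableSpace Ω] [MeasurableSpace S] {P : Measure Ω}
  {η : Ω → Measure S} {m : Measure S}

theorem IsPoissonProcess.isProbabilityMeasure (hη : IsPoissonProcess P η m) :
    IsProbabilityMeasure P := by
  have hmeas : Measurable fun ω => η ω univ := (Measure.measurable_coe .univ).comp hη.measurable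
  rw [← Measure.isProbabilityMeasure_map_iff hmeas.aemeasurable, hη.count_law univ .univ]
  infer_instance

theorem IsPoissonProcess.iIndepFun_preimage (hη : IsPoissonProcess P η m)
    (u : SimpleFunc S ℝ≥0∞) : iIndepFun (fun (v : u.range) ω => η ω (u ⁻¹' {v.1})) P := by
  let value : Fin u.range.card ≃ u.range := u.range.equivFin.symm
  have h := hη.count_indep _ (fun j => u ⁻¹' {(value j).1}) (fun j => u.measurableSet_preimage _)
    fun j k hjk => Disjoint.preimage _ <| disjoint_singleton.2 fun he =>
      hjk (value.injective (Subtype.ext he))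
  simpa [Function.comp_def, value] using h.precomp value.symm.injective

theorem IsPoissonProcess.lintegral_expNeg_simpleFunc (hη : IsPoissonProcess P η m)
    (u : SimpleFunc S ℝ≥0∞) :
    ∫⁻ ω, expNeg (∫⁻ s, u s ∂η ω) ∂P = expNeg (∫⁻ s, 1 - expNeg (u s) ∂m) := by
  have hmul (v : ℝ≥0∞) : Measurable fun x => expNeg (v * x) :=
    measurable_expNeg.comp (measurable_id.const_mul v)
  have hcount (v : ℝ≥0∞) : Measurable fun ω => η ω (u ⁻¹' {v}) :=
    (Measure.measurable_coe (u.measurableSet_preimage _)).comp hη.measurable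
  calc ∫⁻ ω, expNeg (∫⁻ s, u s ∂η ω) ∂P
    _ = ∫⁻ ω, ∏ v : u.range, expNeg (v * η ω (u ⁻¹' {v.1})) ∂P := by
      simp_rw [SimpleFunc.lintegral_eq_lintegral, SimpleFunc.lintegral, expNeg_sum,
        ← Finset.prod_coe_sort u.range]
    _ = ∏ v : u.range, ∫⁻ ω, expNeg (v * η ω (u ⁻¹' {v.1})) ∂P :=
      lintegral_prod_eq_prod_lintegral_of_indepFun _ _
        ((hη.iIndepFun_preimage u).comp _ fun v => hmul v) fun v => (hmul v).comp (hcount v)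
    _ = ∏ v : u.range, expNeg (m (u ⁻¹' {v.1}) * (1 - expNeg v)) := by
      refine Finset.prod_congr rfl fun v _ => ?_
      rw [← lintegral_expNeg_mul_poissonENNReal, ← hη.count_law _ (u.measurableSet_preimage _),
        lintegral_map (hmul v) (hcount v)]
    _ = expNeg ((u.map fun v => 1 - expNeg v).lintegral m) := by
      simp_rw [SimpleFunc.map_lintegral, expNeg_sum, ← Finset.prod_coe_sort u.range, mul_comm]
    _ = expNeg (∫⁻ s, 1 - expNeg (u s) ∂m) := by rw [← SimpleFunc.lintegral_eq_lintegral]; rfl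

theorem IsPoissonProcess.laplaceFunctional (hη : IsPoissonProcess P η m) {u : S → ℝ≥0∞}
    (hu : Measurable u) :
    ∫⁻ ω, expNeg (∫⁻ s, u s ∂η ω) ∂P = expNeg (∫⁻ s, 1 - expNeg (u s) ∂m) := by
  have := hη.isProbabilityMeasure
  have hmono (s : S) : Monotone fun n => SimpleFunc.eapprox u n s := fun i j hij =>
    SimpleFunc.monotone_eapprox u hij s
  have hintegral (μ : Measure S) : Filter.Tendsto (fun n => ∫⁻ s, SimpleFunc.eapprox u n s ∂μ)
      Filter.atTop (nhds (∫⁻ s, u s ∂μ)) :=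
    lintegral_tendsto_of_tendsto_of_monotone (fun n => (SimpleFunc.measurable _).aemeasurable)
      (ae_of_all _ hmono) (ae_of_all _ fun s => SimpleFunc.tendsto_eapprox hu s)
  have hleft := tendsto_lintegral_of_dominated_convergence (μ := P) 1
    (F := fun n ω => expNeg (∫⁻ s, SimpleFunc.eapprox u n s ∂η ω))
    (fun n => measurable_expNeg.comp <|
      (Measure.measurable_lintegral (SimpleFunc.measurable _)).comp hη.measurable)
    (fun n => ae_of_all _ fun ω => expNeg_le_one _) (by simp)
    (ae_of_all _ fun ω => (continuous_expNeg.tendsto _).comp (hintegral (η ω)))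
  have hcomp : Continuous fun x => 1 - expNeg x :=
    (ENNReal.continuous_sub_left ENNReal.one_ne_top).comp continuous_expNeg
  have hright := lintegral_tendsto_of_tendsto_of_monotone (μ := m)
    (f := fun n s => 1 - expNeg (SimpleFunc.eapprox u n s))
    (fun n => (hcomp.measurable.comp (SimpleFunc.measurable _)).aemeasurable)
    (ae_of_all _ fun s i j hij => tsub_le_tsub_left (antitone_expNeg (hmono s hij)) 1)
    (ae_of_all _ fun s => (hcomp.tendsto _).comp (SimpleFunc.tendsto_eapprox hu s))
  refine tendsto_nhds_unique hleft ?_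
  simp_rw [hη.lintegral_expNeg_simpleFunc]
  exact (continuous_expNeg.tendsto _).comp hright

theorem IsPoissonProcess.lintegral_prod {N : Ω → ℕ} {Z : ℕ → Ω → S}
    (hη : IsPoissonProcess P (fun ω => ∑ k ∈ Finset.range (N ω), Measure.dirac (Z k ω)) m)
    {h : S → ℝ≥0∞} (hh : Measurable h) (h1 : ∀ s, h s ≤ 1) :
    ∫⁻ ω, ∏ k ∈ Finset.range (N ω), h (Z k ω) ∂P = expNeg (∫⁻ s, 1 - h s ∂m) := by
  have hu : Measurable fun s => (-(h s).log).toENNReal :=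
    (ENNReal.measurable_log.comp hh).neg.ereal_toENNReal
  have hexp (s : S) : expNeg (-(h s).log).toENNReal = h s := expNeg_toENNReal_neg_log (h1 s)
  simpa only [lintegral_finsetSum_measure, lintegral_dirac' _ hu, expNeg_sum, hexp]
    using hη.laplaceFunctional hu

end Poisson

section Marking

theorem lintegral_eq_tsum_fiber {Ω τ : Type*} [MeasurableSpace Ω] [Countable τ] {T : Ω → τ}
    (hT : ∀ t, MeasurableSet {ω | T ω = t}) (P : Measure Ω) (f : Ω → ℝ≥0∞) :
    ∫⁻ ω, f ω ∂P = ∑' t, ∫⁻ ω in {ω | T ω = t}, f ω ∂P := by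
  rw [← lintegral_iUnion hT (fun s t hst => disjoint_left.2 fun ω hs ht => hst (hs.symm.trans ht)),
    iUnion_eq_univ_iff.2 fun ω => ⟨T ω, rfl⟩, setLIntegral_univ]

variable {Ω S E : Type*} [MeasurableSpace Ω] [MeasurableSpace S]

/-- Independent marking of `N` random points `Z 0, …, Z (N - 1)`: given the points, the marks `D k`
are independent, and `D k = e` with probability `q e (Z k)`. -/
structure IsIndepMarking (P : Measure Ω) (q : E → S → ℝ≥0∞) (N : Ω → ℕ) (Z : ℕ → Ω → S)
    (D : ℕ → Ω → E) : Prop where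
  measurable_num : Measurable N
  measurable_point : ∀ k, Measurable (Z k)
  measurableSet_mark : ∀ k e, MeasurableSet {ω | D k ω = e}
  measure_marks : ∀ (n : ℕ) (e : Fin n → E) (B : Set (Fin n → S)), MeasurableSet B →
    P {ω | (N ω = n ∧ (fun k : Fin n => Z k ω) ∈ B) ∧ ∀ k : Fin n, D k ω = e k} =
      ∫⁻ ω in {ω | N ω = n ∧ (fun k : Fin n => Z k ω) ∈ B}, ∏ k : Fin n, q (e k) (Z k ω) ∂P

namespace IsIndepMarking

variable {P : Measure Ω} {q : E → S → ℝ≥0∞} {N : Ω → ℕ} {Z : ℕ → Ω → S} {D : ℕ → Ω → E}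

theorem measurableSet_num (hD : IsIndepMarking P q N Z D) (n : ℕ) :
    MeasurableSet {ω | N ω = n} := hD.measurable_num (measurableSet_singleton n)

theorem measurable_points (hD : IsIndepMarking P q N Z D) (n : ℕ) :
    Measurable fun ω (k : Fin n) => Z k ω := measurable_pi_lambda _ fun k => hD.measurable_point k

theorem measurableSet_marks (hD : IsIndepMarking P q N Z D) (n : ℕ) (e : Fin n → E) :
    MeasurableSet {ω | (fun k : Fin n => D k ω) = e} := by
  simp only [funext_iff, ofPred_forall]
  exact MeasurableSet.iInter fun k => hD.measurableSet_mark k (e k)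

theorem map_points_restrict_marks (hD : IsIndepMarking P q N Z D) (n : ℕ) (e : Fin n → E) :
    ((P.restrict {ω | N ω = n}).restrict {ω | (fun k : Fin n => D k ω) = e}).map
        (fun ω (k : Fin n) => Z k ω) =
      ((P.restrict {ω | N ω = n}).withDensity fun ω => ∏ k : Fin n, q (e k) (Z k ω)).map
        fun ω (k : Fin n) => Z k ω := by
  have hZ := hD.measurable_points n
  ext B hB
  rw [Measure.map_apply hZ hB, Measure.map_apply hZ hB, withDensity_apply _ (hZ hB),
    Measure.restrict_restrict (hZ hB), Measure.restrict_apply (hZ hB),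
    Measure.restrict_apply ((hZ hB).inter (hD.measurableSet_marks n e))]
  convert hD.measure_marks n e B hB using 2
  · ext ω
    simp only [mem_inter_iff, mem_preimage, mem_ofPred_eq, funext_iff]
    tauto
  · congr 1
    exact inter_comm _ _

theorem setLIntegral_marks (hD : IsIndepMarking P q N Z D) (hq : ∀ e, Measurable (q e)) (n : ℕ)
    (e : Fin n → E) {G : (Fin n → S) → ℝ≥0∞} (hG : Measurable G) :
    ∫⁻ ω in {ω | (fun k : Fin n => D k ω) = e}, G (fun k => Z k ω) ∂P.restrict {ω | N ω = n} =
      ∫⁻ ω in {ω | N ω = n}, (∏ k : Fin n, q (e k) (Z k ω)) * G (fun k => Z k ω) ∂P := by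
  have hprod : Measurable fun ω => ∏ k : Fin n, q (e k) (Z k ω) :=
    Finset.measurable_prod _ fun k _ => (hq (e k)).comp (hD.measurable_point k)
  rw [← lintegral_map hG (hD.measurable_points n), hD.map_points_restrict_marks,
    lintegral_map hG (hD.measurable_points n)]
  exact lintegral_withDensity_eq_lintegral_mul _ hprod (hG.comp (hD.measurable_points n))

variable [Fintype E] {w : E → S → ℝ≥0∞}

theorem setLIntegral_prod (hD : IsIndepMarking P q N Z D) (hq : ∀ e, Measurable (q e))
    (hw : ∀ e, Measurable (w e)) (n : ℕ) :
    ∫⁻ ω in {ω | N ω = n}, ∏ k : Fin n, w (D k ω) (Z k ω) ∂P =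
      ∫⁻ ω in {ω | N ω = n}, ∏ k : Fin n, ∑ e, q e (Z k ω) * w e (Z k ω) ∂P := by
  classical
  have hqw (e : Fin n → E) : Measurable fun ω => ∏ k : Fin n, q (e k) (Z k ω) * w (e k) (Z k ω) :=
    Finset.measurable_prod _ fun k _ =>
      ((hq _).comp (hD.measurable_point k)).mul ((hw _).comp (hD.measurable_point k))
  calc ∫⁻ ω in {ω | N ω = n}, ∏ k : Fin n, w (D k ω) (Z k ω) ∂P
    _ = ∑ e : Fin n → E, ∫⁻ ω in {ω | (fun k : Fin n => D k ω) = e}, ∏ k : Fin n, w (e k) (Z k ω)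
          ∂P.restrict {ω | N ω = n} := by
      rw [lintegral_eq_tsum_fiber (hD.measurableSet_marks n), tsum_fintype]
      refine Finset.sum_congr rfl fun e _ => setLIntegral_congr_fun (hD.measurableSet_marks n e) ?_
      rintro ω rfl
      rfl
    _ = ∑ e : Fin n → E, ∫⁻ ω in {ω | N ω = n},
          ∏ k : Fin n, q (e k) (Z k ω) * w (e k) (Z k ω) ∂P := by
      refine Finset.sum_congr rfl fun e _ => ?_
      simp_rw [Finset.prod_mul_distrib]
      exact hD.setLIntegral_marks hq n e (G := fun z => ∏ k, w (e k) (z k)) <|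
        Finset.measurable_prod _ fun k _ => (hw _).comp (measurable_pi_apply k)
    _ = ∫⁻ ω in {ω | N ω = n}, ∏ k : Fin n, ∑ e, q e (Z k ω) * w e (Z k ω) ∂P := by
      rw [← lintegral_finsetSum _ fun e _ => hqw e]
      simp_rw [Finset.prod_univ_sum, Fintype.piFinset_univ]

theorem lintegral_prod (hD : IsIndepMarking P q N Z D) (hq : ∀ e, Measurable (q e))
    (hw : ∀ e, Measurable (w e)) :
    ∫⁻ ω, ∏ k ∈ Finset.range (N ω), w (D k ω) (Z k ω) ∂P =
      ∫⁻ ω, ∏ k ∈ Finset.range (N ω), ∑ e, q e (Z k ω) * w e (Z k ω) ∂P := by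
  have hfiber (f : ℕ → Ω → ℝ≥0∞) : ∫⁻ ω, ∏ k ∈ Finset.range (N ω), f k ω ∂P =
      ∑' n, ∫⁻ ω in {ω | N ω = n}, ∏ k : Fin n, f k ω ∂P := by
    rw [lintegral_eq_tsum_fiber hD.measurableSet_num]
    refine tsum_congr fun n => setLIntegral_congr_fun (hD.measurableSet_num n) ?_
    rintro ω rfl
    exact Finset.prod_range _
  rw [hfiber fun k ω => w (D k ω) (Z k ω), hfiber fun k ω => ∑ e, q e (Z k ω) * w e (Z k ω)]
  exact tsum_congr fun n => hD.setLIntegral_prod hq hw n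

theorem lintegral_prod_of_isPoissonProcess {m : Measure S} (hD : IsIndepMarking P q N Z D)
    (hη : IsPoissonProcess P (fun ω => ∑ k ∈ Finset.range (N ω), Measure.dirac (Z k ω)) m)
    (hq : ∀ e, Measurable (q e)) (hq1 : ∀ s, ∑ e, q e s = 1) (hw : ∀ e, Measurable (w e))
    (hw1 : ∀ e s, w e s ≤ 1) :
    ∫⁻ ω, ∏ k ∈ Finset.range (N ω), w (D k ω) (Z k ω) ∂P =
      expNeg (∑ e, ∫⁻ s, q e s * (1 - w e s) ∂m) := by
  have hmeas (e : E) : Measurable fun s => q e s * (1 - w e s) := (hq e).mul ((hw e).const_sub 1)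
  have hadd (s : S) : ∑ e, q e s * (1 - w e s) + ∑ e, q e s * w e s = 1 := by
    simp_rw [← Finset.sum_add_distrib, ← mul_add, tsub_add_cancel_of_le (hw1 _ s), mul_one, hq1]
  have hle (s : S) : ∑ e, q e s * w e s ≤ 1 := hadd s ▸ le_add_self
  have hsub (s : S) : 1 - ∑ e, q e s * w e s = ∑ e, q e s * (1 - w e s) :=
    ENNReal.sub_eq_of_eq_add (ne_top_of_le_ne_top ENNReal.one_ne_top (hle s)) (hadd s).symm
  rw [hD.lintegral_prod hq hw, hη.lintegral_prod (h := fun s => ∑ e, q e s * w e s)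
    (Finset.measurable_sum _ fun e _ => (hq e).mul (hw e)) hle]
  simp_rw [hsub]
  rw [lintegral_finsetSum _ fun e _ => hmeas e]

end IsIndepMarking

end Marking

section Observation

theorem measurable_comp_nat {Ω β : Type*} [MeasurableSpace Ω] [MeasurableSpace β] {N : Ω → ℕ}
    (hN : Measurable N) {F : ℕ → Ω → β} (hF : ∀ n, Measurable (F n)) :
    Measurable fun ω => F (N ω) ω :=
  (measurable_from_prod_countable_right (f := fun z : ℕ × Ω => F z.1 z.2) hF).comp
    (hN.prodMk measurable_id)

variable {Ω X : Type*} {d : ℕ} {N : Ω → ℕ} {Z : ℕ → Ω → I × X} {D : ℕ → Ω → Option (Fin d)}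
  {u : Fin d → I → ℝ≥0∞}

theorem expNeg_sum_lintegral_observation (hu : ∀ i, Measurable (u i)) (ω : Ω) :
    expNeg (∑ i, ∫⁻ t, u i t ∂observation N Z D ω i) =
      ∏ k ∈ Finset.range (N ω), (D k ω).elim 1 fun i => expNeg (u i (Z k ω).1) := by
  classical
  have hdetector (i : Fin d) : expNeg (∫⁻ t, u i t ∂observation N Z D ω i) =
      ∏ k ∈ Finset.range (N ω), if D k ω = some i then expNeg (u i (Z k ω).1) else 1 := by
    rw [observation, lintegral_finsetSum_measure, expNeg_sum, ← Finset.prod_filter]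
    exact Finset.prod_congr (by congr) fun k _ => by rw [lintegral_dirac' _ (hu i)]
  simp_rw [expNeg_sum, hdetector]
  rw [Finset.prod_comm]
  refine Finset.prod_congr rfl fun k _ => ?_
  cases D k ω <;> simp

theorem sum_ofReal_markProb {p : Fin d → X → ℝ} {x : X} (h0 : ∀ i, 0 ≤ p i x)
    (h1 : ∑ i, p i x ≤ 1) :
    ∑ e, ENNReal.ofReal (markProb p e x) = 1 := by
  rw [← ENNReal.ofReal_sum_of_nonneg, Fintype.sum_option]
  · simp [markProb]
  · rintro (_ | i) -
    · exact sub_nonneg.2 h1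
    · exact h0 i

variable [MeasurableSpace Ω] [MeasurableSpace X] {P : Measure Ω} {m : Measure (I × X)}
  {p : Fin d → X → ℝ}

theorem measurable_markProb (hp : ∀ i, Measurable (p i)) :
    ∀ e, Measurable (markProb p e)
  | none => measurable_const.sub (Finset.measurable_sum _ fun i _ => hp i)
  | some i => hp i

namespace IsExperiment

theorem isIndepMarking (hE : IsExperiment P m p N Z D) :
    IsIndepMarking P (fun e z => ENNReal.ofReal (markProb p e z.2)) N Z D where
  measurable_num := hE.measurable_num
  measurable_point := hE.measurable_point
  measurableSet_mark := hE.measurableSet_mark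
  measure_marks := hE.detection

theorem measurable_observation (hE : IsExperiment P m p N Z D) :
    Measurable (observation N Z D) := by
  classical
  refine measurable_pi_lambda _ fun i => ?_
  refine measurable_comp_nat (F := fun n ω => ∑ k ∈ (Finset.range n).filter
    (fun k => D k ω = some i), Measure.dirac (Z k ω).1) hE.measurable_num fun n => ?_
  refine Measure.measurable_of_measurable_coe _ fun B hB => ?_
  have hdirac (k : ℕ) (ω : Ω) : (if D k ω = some i then Measure.dirac (Z k ω).1 else 0) B =
      {ω | D k ω = some i}.indicator (fun ω => Measure.dirac (Z k ω).1 B) ω := by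
    by_cases h : D k ω = some i <;> simp [h]
  simp only [Finset.sum_filter, Measure.finsetSum_apply, hdirac]
  exact Finset.measurable_sum _ fun k _ => ((Measure.measurable_coe hB).comp
    (Measure.measurable_dirac.comp (hE.measurable_point k).fst)).indicator
      (hE.measurableSet_mark k _)

theorem laplaceFunctional_observation (hE : IsExperiment P m p N Z D)
    (hp : ∀ i, Measurable (p i)) (h0 : ∀ i x, 0 ≤ p i x) (h1 : ∀ x, ∑ i, p i x ≤ 1)
    (hu : ∀ i, Measurable (u i)) :
    ∫⁻ ω, expNeg (∑ i, ∫⁻ t, u i t ∂observation N Z D ω i) ∂P =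
      expNeg (∑ i, ∫⁻ z, ENNReal.ofReal (p i z.2) * (1 - expNeg (u i z.1)) ∂m) := by
  simp_rw [expNeg_sum_lintegral_observation hu]
  rw [hE.isIndepMarking.lintegral_prod_of_isPoissonProcess hE.emission
    (w := fun e z => e.elim 1 fun i => expNeg (u i z.1))
    (fun e => ((measurable_markProb hp e).comp measurable_snd).ennreal_ofReal)
    (fun z => sum_ofReal_markProb (fun i => h0 i z.2) (h1 z.2)), Fintype.sum_option]
  · simp [markProb]
  · rintro (_ | i)
    · exact measurable_const
    · exact measurable_expNeg.comp ((hu i).comp measurable_fst)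
  · rintro (_ | i) z
    · exact le_rfl
    · exact expNeg_le_one _

end IsExperiment

end Observation

/-! ### Poisson densities on list-mode data -/

section Reference

theorem measurable_sigmaMk {ι : Type*} {S : ι → Type*} [∀ i, MeasurableSpace (S i)] (i : ι) :
    Measurable (Sigma.mk i : S i → Sigma S) :=
  fun _ hs => MeasurableSpace.measurableSet_iInf.1 hs i

theorem measurable_from_sigma {ι : Type*} {S : ι → Type*} [∀ i, MeasurableSpace (S i)]
    {β : Type*} [MeasurableSpace β] {f : Sigma S → β}
    (hf : ∀ i, Measurable fun s : S i => f ⟨i, s⟩) : Measurable f :=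
  fun _ hs => MeasurableSpace.measurableSet_iInf.2 fun i => hf i hs

theorem lintegral_prod_pi {n : ℕ} {E : Fin n → Type*} [∀ i, MeasurableSpace (E i)]
    (μ : ∀ i, Measure (E i)) [∀ i, SigmaFinite (μ i)] {f : ∀ i, E i → ℝ≥0∞}
    (hf : ∀ i, Measurable (f i)) :
    ∫⁻ x, ∏ i, f i (x i) ∂Measure.pi μ = ∏ i, ∫⁻ x, f i x ∂μ i := by
  induction n with
  | zero => simp
  | succ n ih =>
    have hg : Measurable fun y : ∀ i : Fin n, E i.succ => ∏ i, f i.succ (y i) :=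
      Finset.measurable_prod _ fun i _ => (hf i.succ).comp (measurable_pi_apply i)
    rw [Fin.prod_univ_succ, ← ih (fun i => μ i.succ) fun i => hf i.succ,
      ← lintegral_prod_mul (hf 0).aemeasurable hg.aemeasurable]
    refine Eq.trans (lintegral_congr fun x => Fin.prod_univ_succ _) <|
      (measurePreserving_piFinSuccAbove μ 0).lintegral_comp
        (((hf 0).comp measurable_fst).mul (hg.comp measurable_snd))

theorem measurable_prod_list {T M : Type*} [MeasurableSpace T] [CommMonoid M] [MeasurableSpace M]
    [MeasurableMul₂ M] {f : T → M} (hf : Measurable f) :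
    Measurable fun z : (n : ℕ) × (Fin n → T) => ∏ j, f (z.2 j) :=
  measurable_from_sigma fun _ =>
    Finset.measurable_prod Finset.univ fun j _ => hf.comp (measurable_pi_apply j)

theorem lintegral_refList {f : I → ℝ≥0∞} (hf : Measurable f) :
    ∫⁻ z, ∏ j, f (z.2 j) ∂refList = EReal.exp (∫⁻ t, f t : ℝ≥0∞) := by
  rw [refList, lintegral_sum_measure, ← tsum_inv_factorial_mul_pow]
  refine tsum_congr fun n => ?_
  rw [lintegral_smul_measure, lintegral_map (measurable_prod_list hf) (measurable_sigmaMk n),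
    volume_pi, lintegral_prod_pi _ fun _ => hf, Finset.prod_const, Finset.card_fin, smul_eq_mul]

instance isFiniteMeasure_refList : IsFiniteMeasure refList := by
  have h := lintegral_refList (f := 1) measurable_one
  simp only [Pi.one_apply, Finset.prod_const_one, lintegral_one, measure_univ] at h
  exact ⟨h ▸ EReal.exp_lt_top_iff.2 (EReal.coe_lt_top 1)⟩

variable {d : ℕ}

theorem measurable_toPoints : Measurable (Data.toPoints (d := d)) := by
  have h : Measurable fun z : (n : ℕ) × (Fin n → I) => ∑ j, Measure.dirac (z.2 j) := by
    refine measurable_from_sigma fun n => Measure.measurable_of_measurable_coe _ fun B hB => ?_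
    simp only [Measure.finsetSum_apply]
    exact Finset.measurable_sum Finset.univ fun j _ => (Measure.measurable_coe hB).comp
      (Measure.measurable_dirac.comp (measurable_pi_apply j))
  exact measurable_pi_lambda _ fun i =>
    h.comp (measurable_pi_apply (X := fun _ : Fin d => (n : ℕ) × (Fin n → I)) i)

theorem expNeg_lintegral_toPoints {u : Fin d → I → ℝ≥0∞} (hu : ∀ i, Measurable (u i))
    (y : Data d) (i : Fin d) :
    expNeg (∫⁻ t, u i t ∂y.toPoints i) = ∏ j, expNeg (u i ((y i).2 j)) := by
  rw [Data.toPoints, lintegral_finsetSum_measure, expNeg_sum]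
  simp_rw [lintegral_dirac' _ (hu i)]

/-- The density of `d` independent Poisson point processes on `[0, 1]`, the `i`-th one of
intensity `β i`, with respect to the reference measure `refData d`. -/
noncomputable def poissonDensity (β : Fin d → I → ℝ≥0∞) (y : Data d) : ℝ≥0∞ :=
  ∏ i, (expNeg (∫⁻ t, β i t) * ∏ j, β i ((y i).2 j))

variable {β : Fin d → I → ℝ≥0∞}

theorem measurable_poissonDensity (hβ : ∀ i, Measurable (β i)) :
    Measurable (poissonDensity β) :=
  Finset.measurable_prod _ fun i _ => ((measurable_prod_list (hβ i)).const_mul _).comp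
    (measurable_pi_apply (X := fun _ : Fin d => (n : ℕ) × (Fin n → I)) i)

theorem poissonDensity_mul_expNeg_toPoints {u : Fin d → I → ℝ≥0∞} (hu : ∀ i, Measurable (u i))
    (y : Data d) :
    poissonDensity β y * expNeg (∑ i, ∫⁻ t, u i t ∂y.toPoints i) =
      ∏ i, (expNeg (∫⁻ t, β i t) * ∏ j, β i ((y i).2 j) * expNeg (u i ((y i).2 j))) := by
  simp_rw [poissonDensity, expNeg_sum, expNeg_lintegral_toPoints hu, ← Finset.prod_mul_distrib,
    mul_assoc, ← Finset.prod_mul_distrib]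

theorem laplaceFunctional_poissonDensity (hβ : ∀ i, Measurable (β i))
    (hfin : ∀ i, ∫⁻ t, β i t ≠ ⊤) {u : Fin d → I → ℝ≥0∞} (hu : ∀ i, Measurable (u i)) :
    ∫⁻ ν, expNeg (∑ i, ∫⁻ t, u i t ∂ν i)
        ∂((refData d).withDensity (poissonDensity β)).map Data.toPoints =
      expNeg (∑ i, ∫⁻ t, β i t * (1 - expNeg (u i t))) := by
  have he (i : Fin d) : Measurable fun t => expNeg (u i t) := measurable_expNeg.comp (hu i)
  have hβe (i : Fin d) : Measurable fun t => β i t * expNeg (u i t) := (hβ i).mul (he i)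
  have hsplit (i : Fin d) : ∫⁻ t, β i t =
      (∫⁻ t, β i t * expNeg (u i t)) + ∫⁻ t, β i t * (1 - expNeg (u i t)) := by
    rw [← lintegral_add_left (hβe i)]
    simp_rw [← mul_add, add_tsub_cancel_of_le (expNeg_le_one _), mul_one]
  have hthin (i : Fin d) : ∫⁻ t, β i t * expNeg (u i t) ≠ ⊤ :=
    ne_top_of_le_ne_top (hfin i) (le_self_add.trans_eq (hsplit i).symm)
  rw [lintegral_map (measurable_expNeg_sum_lintegral hu) measurable_toPoints]
  refine (lintegral_withDensity_eq_lintegral_mul _ (measurable_poissonDensity hβ)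
    ((measurable_expNeg_sum_lintegral hu).comp measurable_toPoints)).trans ?_
  simp only [Pi.mul_apply, Function.comp_apply, poissonDensity_mul_expNeg_toPoints hu]
  have hlist (i : Fin d) := measurable_prod_list (hβe i)
  refine (lintegral_prod_pi (fun _ : Fin d => refList) fun i => (hlist i).const_mul _).trans ?_
  rw [expNeg_sum]
  refine Finset.prod_congr rfl fun i _ => ?_
  rw [lintegral_const_mul _ (hlist i), lintegral_refList (hβe i), mul_comm, hsplit i]
  exact exp_mul_expNeg_add (hthin i)

end Reference

section Law

variable {Ω X : Type*} {d : ℕ} [MeasurableSpace Ω] [MeasurableSpace X] {P : Measure Ω}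
  {m : Measure (I × X)} {p : Fin d → X → ℝ} {N : Ω → ℕ} {Z : ℕ → Ω → I × X}
  {D : ℕ → Ω → Option (Fin d)} {β : Fin d → I → ℝ≥0∞}

theorem IsExperiment.map_observation (hE : IsExperiment P m p N Z D)
    (hp : ∀ i, Measurable (p i)) (h0 : ∀ i x, 0 ≤ p i x) (h1 : ∀ x, ∑ i, p i x ≤ 1)
    (hβ : ∀ i, Measurable (β i)) (hfin : ∀ i, ∫⁻ t, β i t ≠ ⊤)
    (hproj : ∀ i, (m.withDensity fun z => ENNReal.ofReal (p i z.2)).map Prod.fst =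
      volume.withDensity (β i)) :
    P.map (observation N Z D) =
      ((refData d).withDensity (poissonDensity β)).map Data.toPoints := by
  have := hE.emission.isProbabilityMeasure
  refine ext_of_laplaceFunctional fun u hu => ?_
  rw [laplaceFunctional_poissonDensity hβ hfin hu,
    lintegral_map (measurable_expNeg_sum_lintegral hu) hE.measurable_observation,
    hE.laplaceFunctional_observation hp h0 h1 hu]
  have hthin (i : Fin d) : ∫⁻ z, ENNReal.ofReal (p i z.2) * (1 - expNeg (u i z.1)) ∂m =
      ∫⁻ t, β i t * (1 - expNeg (u i t)) := by
    have hg : Measurable fun t => 1 - expNeg (u i t) :=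
      measurable_const.sub (measurable_expNeg.comp (hu i))
    have hq : Measurable fun z : I × X => ENNReal.ofReal (p i z.2) :=
      ((hp i).comp measurable_snd).ennreal_ofReal
    calc ∫⁻ z, ENNReal.ofReal (p i z.2) * (1 - expNeg (u i z.1)) ∂m
        = ∫⁻ z, 1 - expNeg (u i z.1) ∂m.withDensity fun z => ENNReal.ofReal (p i z.2) :=
          (lintegral_withDensity_eq_lintegral_mul _ hq (hg.comp measurable_fst)).symm
      _ = ∫⁻ t, 1 - expNeg (u i t) ∂volume.withDensity (β i) := by
          rw [← hproj i, lintegral_map hg measurable_fst]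
      _ = ∫⁻ t, β i t * (1 - expNeg (u i t)) :=
          lintegral_withDensity_eq_lintegral_mul _ (hβ i) hg
  simp_rw [hthin]

end Law

/-! ### Pairing adjoints with Radon measures -/

section RadonOperators

variable {X : Type*} [TopologicalSpace X]

/-- A family of operators on `M(X)` is weakly measurable if its pairings with nonnegative Radon
measures and continuous functions are measurable in the parameter. -/
def WeaklyMeasurable {T : Type*} [MeasurableSpace T] (W : T → Radon X →L[ℝ] Radon X) : Prop :=
  ∀ (μ : PosRadon X) (g : C(X, ℝ)), Measurable fun t => W t μ.1 g

theorem IsNonneg.mono {μ : Radon X} (hμ : IsNonneg μ) {g h : C(X, ℝ)} (hgh : g ≤ h) :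
    μ g ≤ μ h :=
  sub_nonneg.1 <| map_sub μ h g ▸ hμ (h - g) (sub_nonneg.2 hgh)

/-- The Dirac measure at `x` as a nonnegative Radon measure; it turns values of `adjoint T g` into
pairings of `T`. -/
noncomputable def diracRadon (x : X) : PosRadon X :=
  ⟨StrongDual.toWeakDual (ContinuousMap.evalCLM ℝ x), fun _ hg => hg x⟩

theorem adjoint_apply (T : Radon X →L[ℝ] Radon X) (g : C(X, ℝ)) (x : X) :
    adjoint T g x = T (diracRadon x).1 g :=
  (adjoint_spec T g (diracRadon x).1).symm

variable [CompactSpace X]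

theorem IsNonneg.abs_apply_le {μ : Radon X} (hμ : IsNonneg μ) (g : C(X, ℝ)) :
    |μ g| ≤ ‖g‖ * μ 1 := by
  have hg (x : X) : |g x| ≤ ‖g‖ := g.norm_coe_le_norm x
  have hnorm : ‖g‖ * μ 1 = μ (‖g‖ • (1 : C(X, ℝ))) := by rw [map_smul, smul_eq_mul]
  rw [hnorm, abs_le, ← map_neg]
  constructor <;> refine hμ.mono fun x => ?_
  · simpa using (abs_le.1 (hg x)).1
  · simpa using (abs_le.1 (hg x)).2

theorem norm_adjoint_le {T : Radon X →L[ℝ] Radon X} (hT : ∀ μ, IsNonneg μ → IsNonneg (T μ))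
    (g : C(X, ℝ)) : ‖adjoint T g‖ ≤ ‖g‖ * ‖adjoint T 1‖ := by
  rw [ContinuousMap.norm_le _ (by positivity)]
  intro x
  calc ‖adjoint T g x‖ = |T (diracRadon x).1 g| := by rw [adjoint_apply, Real.norm_eq_abs]
    _ ≤ ‖g‖ * T (diracRadon x).1 1 := (hT _ (diracRadon x).2).abs_apply_le g
    _ = ‖g‖ * adjoint T 1 x := by rw [adjoint_apply]
    _ ≤ ‖g‖ * ‖adjoint T 1‖ := by
        gcongr
        exact (le_abs_self _).trans ((adjoint T 1).norm_coe_le_norm x)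

variable [T2Space X] [SecondCountableTopology X]

theorem stronglyMeasurable_continuousMap {T : Type*} [MeasurableSpace T] {f : T → C(X, ℝ)}
    (hf : ∀ x, Measurable fun t => f t x) : StronglyMeasurable f := by
  -- `C(X, ℝ)` is Polish, so by Lusin-Souslin the continuous injection `restrict` below is a
  -- measurable embedding.
  borelize C(X, ℝ)
  obtain ⟨s, hs, hdense⟩ := TopologicalSpace.exists_countable_dense X
  have : Countable s := hs
  let restrict : C(X, ℝ) → s → ℝ := fun g x => g x
  have hcont : Continuous restrict := by fun_prop
  have hinj : Function.Injective restrict := fun g h hgh =>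
    DFunLike.coe_injective <| g.continuous.ext_on hdense h.continuous
      fun x hx => congr_fun hgh ⟨x, hx⟩
  exact ((hcont.measurableEmbedding hinj).measurable_comp_iff.1 <|
    measurable_pi_lambda _ fun x => hf x).stronglyMeasurable

theorem integrable_adjoint {T : Type*} [MeasurableSpace T] {ν : Measure T}
    {W : T → Radon X →L[ℝ] Radon X} (hW : ∀ t μ, IsNonneg μ → IsNonneg (W t μ))
    (hmeas : WeaklyMeasurable W) (hint : ∫⁻ t, ‖adjoint (W t) 1‖ₑ ∂ν < ⊤) (g : C(X, ℝ)) :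
    Integrable (fun t => adjoint (W t) g) ν := by
  have hadj (g : C(X, ℝ)) : StronglyMeasurable fun t => adjoint (W t) g :=
    stronglyMeasurable_continuousMap fun x => by
      simp_rw [adjoint_apply]
      exact hmeas (diracRadon x) g
  have hone : Integrable (fun t => adjoint (W t) 1) ν := ⟨(hadj 1).aestronglyMeasurable, hint⟩
  exact (hone.norm.const_mul ‖g‖).mono' (hadj g).aestronglyMeasurable
    (ae_of_all _ fun t => norm_adjoint_le (hW t) g)

end RadonOperators

section DetectionIntensity

variable {X : Type*} [TopologicalSpace X] {d : ℕ} {a : Fin d → C(X, ℝ)}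
  {W : I → Radon X →L[ℝ] Radon X}

theorem detIntensity_nonneg (ha : ∀ i, 0 ≤ a i) (hW : PreservesNonneg W) (μ : PosRadon X)
    (i : Fin d) (t : I) : 0 ≤ detIntensity a W μ i t := hW t μ.1 μ.2 _ (ha i)

theorem apply_Gam (μ : PosRadon X) (y : Data d) (e : (i : Fin d) × Fin (y i).1) :
    μ.1 (Gam a W y e) = detIntensity a W μ e.1 ((y e.1).2 e.2) := (adjoint_spec _ _ _).symm

variable [CompactSpace X] [T2Space X] [SecondCountableTopology X]

theorem integrable_detIntensity (hW : PreservesNonneg W) (hmeas : WeaklyMeasurable W)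
    (hint : ∫⁻ t : I, ‖adjoint (W t) 1‖ₑ < ⊤) (μ : PosRadon X) (i : Fin d) :
    Integrable (detIntensity a W μ i) :=
  ((WeakDual.toStrongDual μ.1).integrable_comp (integrable_adjoint hW hmeas hint (a i))).congr
    (ae_of_all _ fun t => (adjoint_spec (W t) (a i) μ.1).symm)

theorem apply_backproj (hW : PreservesNonneg W) (hmeas : WeaklyMeasurable W)
    (hint : ∫⁻ t : I, ‖adjoint (W t) 1‖ₑ < ⊤) (μ : PosRadon X) :
    μ.1 (backproj a W) = ∑ i, ∫ t : I, detIntensity a W μ i t := by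
  have hsum (t : I) : μ.1 (adjoint (W t) (petAdjoint a fun _ => 1)) =
      ∑ i, detIntensity a W μ i t := by
    rw [← adjoint_spec]
    simp [petAdjoint, detIntensity, petOp]
  rw [← integral_finsetSum _ fun i _ => integrable_detIntensity hW hmeas hint μ i]
  simp_rw [← hsum]
  exact ((WeakDual.toStrongDual μ.1).integral_comp_comm
    (integrable_adjoint hW hmeas hint (petAdjoint a fun _ => 1))).symm

end DetectionIntensity

section TimeSpaceMeasure

theorem measurable_map_prodMk {T X : Type*} [MeasurableSpace T] [MeasurableSpace X]
    {κ : T → Measure X} [∀ t, IsFiniteMeasure (κ t)] (hκ : Measurable κ) :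
    Measurable fun t => (κ t).map (Prod.mk t) := by
  refine Measure.measurable_of_measurable_coe _ fun B hB => ?_
  simp_rw [Measure.map_apply measurable_prodMk_left hB]
  exact Kernel.measurable_kernel_prodMk_left_of_finite (κ := ⟨κ, hκ⟩) hB inferInstance

variable {X : Type*} [TopologicalSpace X] [CompactSpace X] [T2Space X] [MeasurableSpace X]
  [BorelSpace X]

instance isFiniteMeasure_borel (μ : PosRadon X) : IsFiniteMeasure μ.borel :=
  inferInstanceAs (IsFiniteMeasure (RealRMK.rieszMeasure _))

theorem PosRadon.lintegral_borel (μ : PosRadon X) {g : C(X, ℝ)} (hg : 0 ≤ g) :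
    ∫⁻ x, ENNReal.ofReal (g x) ∂μ.borel = ENNReal.ofReal (μ.1 g) := by
  rw [← μ.integral_borel, ofReal_integral_eq_lintegral_ofReal
    (g.continuous.integrable_of_hasCompactSupport (HasCompactSupport.of_compactSpace _))
    (ae_of_all _ fun x => hg x)]

variable [HasOuterApproxClosed X]

theorem measurable_borel {T : Type*} [MeasurableSpace T] {μ : T → PosRadon X}
    (hμ : ∀ g : C(X, ℝ), Measurable fun t => (μ t).1 g) : Measurable fun t => (μ t).borel := by
  have hclosed (F : Set X) (hF : IsClosed F) : Measurable fun t => (μ t).borel F := by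
    refine measurable_of_tendsto_metrizable' (f := fun (n : ℕ) t =>
      ∫⁻ x, hF.apprSeq n x ∂(μ t).borel) Filter.atTop (fun n => ?_)
      (tendsto_pi_nhds.2 fun t => HasOuterApproxClosed.tendsto_lintegral_apprSeq hF _)
    let g : C(X, ℝ) := ⟨fun x => (hF.apprSeq n x : ℝ), by fun_prop⟩
    have hg (t : T) : ∫⁻ x, hF.apprSeq n x ∂(μ t).borel = ENNReal.ofReal ((μ t).1 g) := by
      rw [← (μ t).lintegral_borel (g := g) fun x => NNReal.coe_nonneg _]
      simp [g]
    simp_rw [hg]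
    exact (hμ g).ennreal_ofReal
  exact Measurable.measure_of_isPiSystem
    (BorelSpace.measurable_eq.trans borel_eq_generateFrom_isClosed) isPiSystem_isClosed hclosed
    (hclosed _ isClosed_univ)

variable {W : I → Radon X →L[ℝ] Radon X} (hW : PreservesNonneg W)

theorem lintegral_timeSpaceMeasure (hmeas : WeaklyMeasurable W) (μ : PosRadon X)
    {F : I × X → ℝ≥0∞} (hF : Measurable F) :
    ∫⁻ z, F z ∂timeSpaceMeasure W hW μ = ∫⁻ t, ∫⁻ x, F (t, x) ∂(activity W hW μ t).borel := by
  have hborel : Measurable fun t => (activity W hW μ t).borel := measurable_borel (hmeas μ)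
  rw [timeSpaceMeasure, Measure.lintegral_bind (measurable_map_prodMk hborel).aemeasurable
    hF.aemeasurable]
  exact lintegral_congr fun t => lintegral_map hF measurable_prodMk_left

theorem map_fst_withDensity_timeSpaceMeasure (hmeas : WeaklyMeasurable W) (μ : PosRadon X)
    {g : C(X, ℝ)} (hg : 0 ≤ g) :
    ((timeSpaceMeasure W hW μ).withDensity fun z => ENNReal.ofReal (g z.2)).map Prod.fst =
      volume.withDensity fun t => ENNReal.ofReal (W t μ.1 g) := by
  have hgx : Measurable fun x => ENNReal.ofReal (g x) := g.continuous.measurable.ennreal_ofReal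
  have hgz : Measurable fun z : I × X => ENNReal.ofReal (g z.2) := hgx.comp measurable_snd
  refine Measure.ext_of_lintegral _ fun v hv => ?_
  calc ∫⁻ t, v t
        ∂((timeSpaceMeasure W hW μ).withDensity fun z => ENNReal.ofReal (g z.2)).map Prod.fst
      = ∫⁻ z, ENNReal.ofReal (g z.2) * v z.1 ∂timeSpaceMeasure W hW μ := by
        rw [lintegral_map hv measurable_fst]
        exact lintegral_withDensity_eq_lintegral_mul _ hgz (hv.comp measurable_fst)
    _ = ∫⁻ t, ENNReal.ofReal (W t μ.1 g) * v t := by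
        refine (lintegral_timeSpaceMeasure hW hmeas μ (hgz.mul (hv.comp measurable_fst))).trans
          (lintegral_congr fun t => ?_)
        simp only [Pi.mul_apply, Function.comp_apply]
        rw [lintegral_mul_const _ hgx, PosRadon.lintegral_borel _ hg]
        rfl
    _ = ∫⁻ t, v t ∂volume.withDensity fun t => ENNReal.ofReal (W t μ.1 g) :=
        (lintegral_withDensity_eq_lintegral_mul _ (hmeas μ g).ennreal_ofReal hv).symm

theorem map_fst_withDensity_smul_timeSpaceMeasure (hmeas : WeaklyMeasurable W) (μ : PosRadon X)
    {g : C(X, ℝ)} (hg : 0 ≤ g) {c : ℝ≥0} (hc : 0 < c) :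
    ((c • timeSpaceMeasure W hW μ).withDensity fun z => ENNReal.ofReal (g z.2 / c)).map
        Prod.fst = volume.withDensity fun t => ENNReal.ofReal (W t μ.1 g) := by
  have hgz : Measurable fun z : I × X => ENNReal.ofReal (g z.2 / c) :=
    ((g.continuous.measurable.comp measurable_snd).div_const _).ennreal_ofReal
  have hcancel : (c : ℝ≥0∞) • (fun z : I × X => ENNReal.ofReal (g z.2 / c)) =
      fun z => ENNReal.ofReal (g z.2) := by
    ext z
    rw [Pi.smul_apply, smul_eq_mul, ENNReal.ofReal_div_of_pos (NNReal.coe_pos.2 hc),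
      ENNReal.ofReal_coe_nnreal, ENNReal.mul_div_cancel (by simpa using hc.ne') (by simp)]
  rw [← map_fst_withDensity_timeSpaceMeasure hW hmeas μ hg, ← hcancel, withDensity_smul _ hgz,
    ← withDensity_smul_measure]
  rfl

end TimeSpaceMeasure

section Loss

variable {X : Type*} [TopologicalSpace X] {d : ℕ} {a : Fin d → C(X, ℝ)}
  {W : I → Radon X →L[ℝ] Radon X}

theorem measurable_likelihood (hmeas : WeaklyMeasurable W) (μ : PosRadon X) :
    Measurable (likelihood a W μ) :=
  ENNReal.measurable_ofReal.comp <| Finset.measurable_prod _ fun i _ =>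
    ((measurable_prod_list (hmeas μ (a i))).const_mul _).comp
      (measurable_pi_apply (X := fun _ : Fin d => (n : ℕ) × (Fin n → I)) i)

variable [CompactSpace X] [T2Space X] [SecondCountableTopology X]

theorem likelihood_eq_exp_mul_prod (hW : PreservesNonneg W) (hmeas : WeaklyMeasurable W)
    (hint : ∫⁻ t : I, ‖adjoint (W t) 1‖ₑ < ⊤) (y : Data d) (μ : PosRadon X) :
    likelihood a W μ y =
      ENNReal.ofReal (Real.exp (-μ.1 (backproj a W)) * ∏ e, μ.1 (Gam a W y e)) := by
  simp_rw [likelihood, apply_backproj hW hmeas hint, apply_Gam, Finset.prod_mul_distrib,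
    ← Finset.sum_neg_distrib, Real.exp_sum, Fintype.prod_sigma]

theorem neg_log_likelihood (ha : ∀ i, 0 ≤ a i) (hW : PreservesNonneg W)
    (hmeas : WeaklyMeasurable W) (hint : ∫⁻ t : I, ‖adjoint (W t) 1‖ₑ < ⊤) (y : Data d)
    (μ : PosRadon X) : -(likelihood a W μ y).log = loss a W y μ := by
  rw [likelihood_eq_exp_mul_prod hW hmeas hint, loss]
  split_ifs with hdom
  · have hprod : 0 < ∏ e, μ.1 (Gam a W y e) := Finset.prod_pos fun e _ => hdom e
    rw [ENNReal.log_ofReal_of_pos (by positivity), Real.log_mul (Real.exp_ne_zero _) hprod.ne',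
      Real.log_exp, Real.log_prod fun e _ => (hdom e).ne', ← EReal.coe_neg]
    congr 1
    ring
  · obtain ⟨e, he⟩ := not_forall.1 hdom
    have hzero : μ.1 (Gam a W y e) = 0 :=
      le_antisymm (not_lt.1 he) (apply_Gam μ y e ▸ detIntensity_nonneg ha hW μ _ _)
    rw [Finset.prod_eq_zero (Finset.mem_univ e) hzero]
    simp

theorem isMaxOn_likelihood_iff_isMinOn_loss (ha : ∀ i, 0 ≤ a i) (hW : PreservesNonneg W)
    (hmeas : WeaklyMeasurable W) (hint : ∫⁻ t : I, ‖adjoint (W t) 1‖ₑ < ⊤) (y : Data d)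
    (μ : PosRadon X) :
    IsMaxOn (fun ν : PosRadon X => likelihood a W ν y) univ μ ↔ IsMinOn (loss a W y) univ μ := by
  simp only [isMaxOn_iff, isMinOn_iff, ← neg_log_likelihood ha hW hmeas hint y,
    EReal.neg_le_neg_iff, ENNReal.log_le_log_iff]

theorem likelihood_eq_poissonDensity (ha : ∀ i, 0 ≤ a i) (hW : PreservesNonneg W)
    (hmeas : WeaklyMeasurable W) (hint : ∫⁻ t : I, ‖adjoint (W t) 1‖ₑ < ⊤) (μ : PosRadon X) :
    likelihood a W μ = poissonDensity fun i t => ENNReal.ofReal (detIntensity a W μ i t) := by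
  have h0 := detIntensity_nonneg ha hW μ
  funext y
  rw [likelihood, poissonDensity, ENNReal.ofReal_prod_of_nonneg fun i _ =>
    mul_nonneg (Real.exp_pos _).le (Finset.prod_nonneg fun j _ => h0 i _)]
  refine Finset.prod_congr rfl fun i _ => ?_
  rw [ENNReal.ofReal_mul (Real.exp_pos _).le, ENNReal.ofReal_prod_of_nonneg fun j _ => h0 i _,
    ← ofReal_integral_eq_lintegral_ofReal (integrable_detIntensity hW hmeas hint μ i)
      (ae_of_all _ (h0 i)), expNeg_ofReal (integral_nonneg (h0 i))]

theorem IsExperiment.map_observation_eq_withDensity_likelihood [MeasurableSpace X]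
    [BorelSpace X] (ha : ∀ i, 0 ≤ a i) {hW : PreservesNonneg W} (hmeas : WeaklyMeasurable W)
    (hint : ∫⁻ t : I, ‖adjoint (W t) 1‖ₑ < ⊤) {μ : PosRadon X} {c : ℝ≥0} (hc : 0 < c)
    (hac : ∀ x, ∑ i, a i x ≤ c) {Ω : Type*} [MeasurableSpace Ω] {P : Measure Ω} {N : Ω → ℕ}
    {Z : ℕ → Ω → I × X} {D : ℕ → Ω → Option (Fin d)}
    (hE : IsExperiment P (c • timeSpaceMeasure W hW μ) (fun i x => a i x / c) N Z D) :
    P.map (observation N Z D) =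
      ((refData d).withDensity (likelihood a W μ)).map Data.toPoints := by
  have := TopologicalSpace.metrizableSpace_of_t3_secondCountable X
  rw [likelihood_eq_poissonDensity ha hW hmeas hint]
  refine hE.map_observation (fun i => (a i).continuous.measurable.div_const _)
    (fun i x => div_nonneg (ha i x) c.2) (fun x => ?_)
    (fun i => (hmeas μ (a i)).ennreal_ofReal)
    (fun i => (integrable_detIntensity hW hmeas hint μ i).lintegral_lt_top.ne)
    fun i => map_fst_withDensity_smul_timeSpaceMeasure hW hmeas μ (ha i) hc
  rw [← Finset.sum_div]
  exact div_le_one_of_le₀ (hac x) c.2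

end Loss

end ListModePET

theorem mainTheorem2_general {X : Type*} [TopologicalSpace X] [CompactSpace X] [T2Space X]
    [SecondCountableTopology X] [MeasurableSpace X] [BorelSpace X] {d : ℕ} (a : Fin d → C(X, ℝ))
    (ha : ∀ i, 0 ≤ a i) (W : I → Radon X →L[ℝ] Radon X) (hW : PreservesNonneg W)
    (hmeas : WeaklyMeasurable W) (hint : ∫⁻ t : I, ‖adjoint (W t) 1‖ₑ < ⊤) :
    Integrable (fun t : I => adjoint (W t) (petAdjoint a fun _ => 1)) ∧
    (∀ (μ : PosRadon X) (i : Fin d), Integrable (detIntensity a W μ i)) ∧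
    (∀ μ : PosRadon X, Measurable (likelihood a W μ) ∧
      ∀ c : ℝ≥0, 0 < c → (∀ x, ∑ i, a i x ≤ c) →
      ∀ (Ω : Type*) [MeasurableSpace Ω] (P : Measure Ω)
        (N : Ω → ℕ) (Z : ℕ → Ω → I × X) (D : ℕ → Ω → Option (Fin d)),
        IsExperiment P (c • timeSpaceMeasure W hW μ) (fun i x => a i x / c) N Z D →
        P.map (observation N Z D) =
          ((refData d).withDensity (likelihood a W μ)).map Data.toPoints) ∧
    (∀ (y : Data d) (μ : PosRadon X), -(likelihood a W μ y).log = loss a W y μ) ∧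
    (∀ (y : Data d) (μ : PosRadon X),
      IsMaxOn (fun ν : PosRadon X => likelihood a W ν y) univ μ ↔
        IsMinOn (loss a W y) univ μ) :=
  ⟨integrable_adjoint hW hmeas hint _, integrable_detIntensity hW hmeas hint,
    fun μ => ⟨measurable_likelihood hmeas μ, fun _ hc hac _ _ _ _ _ _ hE =>
      hE.map_observation_eq_withDensity_likelihood ha hmeas hint hc hac⟩,
    neg_log_likelihood ha hW hmeas hint, isMaxOn_likelihood_iff_isMinOn_loss ha hW hmeas hint⟩

theorem mainTheorem2 (p d : ℕ) (K : TopologicalSpace.Compacts (EuclideanSpace ℝ (Fin p)))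
    (a : Fin d → C(K, ℝ)) (ha : ∀ i, 0 ≤ a i)
    (W : I → Radon K →L[ℝ] Radon K)
    (hW : PreservesNonneg W)
    (hmeas : ∀ (μ : PosRadon K) (g : C(K, ℝ)), Measurable fun t : I => W t μ.1 g)
    (hint : ∫⁻ t : I, ‖adjoint (W t) 1‖ₑ < ⊤) :
    Integrable (fun t : I => adjoint (W t) (petAdjoint a fun _ => 1)) ∧
    (∀ (μ : PosRadon K) (i : Fin d), Integrable (detIntensity a W μ i)) ∧
    (∀ μ : PosRadon K, Measurable (likelihood a W μ) ∧
      ∀ c : ℝ≥0, 0 < c → (∀ x, ∑ i, a i x ≤ c) →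
      ∀ (Ω : Type*) [MeasurableSpace Ω] (P : Measure Ω) [IsProbabilityMeasure P]
        (N : Ω → ℕ) (Z : ℕ → Ω → I × K) (D : ℕ → Ω → Option (Fin d)),
        IsExperiment P (c • timeSpaceMeasure W hW μ) (fun i x => a i x / c) N Z D →
        P.map (observation N Z D) =
          ((refData d).withDensity (likelihood a W μ)).map Data.toPoints) ∧
    (∀ (y : Data d) (μ : PosRadon K), -(likelihood a W μ y).log = loss a W y μ) ∧
    (∀ (y : Data d) (μ : PosRadon K),
      IsMaxOn (fun ν : PosRadon K => likelihood a W ν y) univ μ ↔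
        IsMinOn (loss a W y) univ μ) :=
  let ⟨hf, hβ, hlaw, hlog, hmax⟩ := mainTheorem2_general a ha W hW hmeas hint
  ⟨hf, hβ, fun μ => ⟨(hlaw μ).1, fun c hc hac Ω _ P _ => (hlaw μ).2 c hc hac Ω P⟩, hlog, hmax⟩
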